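/- Let $k\ge 1$ and $t\ge 2$ be integers. For real $c>0$ let $T(k,t,c)$ be the $t\times t$ tridiagonal matrix with subdiagonal $(1,\dots,1,c)$, superdiagonal $(k,k-1,\dots,k-1)$ and all row sums equal to $k$, and let $$M(k,t,c)=1+\sum_{i=0}^{t-3}k(k-1)^i+\frac{k(k-1)^{t-2}}{c}.$$ For real $x$ let $v(k,x)$ be the maximum number of vertices of a connected $k$-regular graph whose second largest adjacency eigenvalue (counted with multiplicity) is at most $x$ ($\infty$ if there is no maximum). Let $\lambda$ be the second largest eigenvalue of $T(k,t,c)$, and suppose that there is a connected $k$-regular graph with second largest eigenvalue at most $\lambda$ and exactly $M(k,t,c)$ vertices. (1) Suppose $c=1$, and for $c_1>0$ let $\lambda_1$ be the second largest eigenvalue of $T(k,t+1,c_1)$. Then $v(k,\lambda_1)=v(k,\lambda)$ whenever $c_1>k(k-1)^{t-1}$. Moreover, if $M(k,t,c)$ is even and $k$ is odd, then $v(k,\lambda_1)=v(k,\lambda)$ whenever $c_1>k(k-1)^{t-1}/2$. (2) Suppose $c>1$, and for $c_2>0$ let $\lambda_2$ be the second largest eigenvalue of $T(k,t,c_2)$.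 Then $v(k,\lambda_2)=v(k,\lambda)$ whenever $$c-\frac{c^2}{k(k-1)^{t-2}+c}<c_2\le c.$$ Moreover, if $M(k,t,c)$ is even and $k$ is odd, then $v(k,\lambda_2)=v(k,\lambda)$ whenever $$c-\frac{2c^2}{k(k-1)^{t-2}+2c}<c_2\le c.$$ -/

import Mathlib

namespace RegularGraph

noncomputable section

/-- The second largest eigenvalue of a real square matrix: the entry of index `1` in the decreasing
list of its real eigenvalues, repeated according to algebraic multiplicity. It is used only for
matrices all of whose eigenvalues are real (adjacency matrices and the matrices `quotientMatrix`)
and which have at least two rows; the value `0` is a placeholder for lists of length at most one. -/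
def secondEigenvalue {n : Type*} [Fintype n] [DecidableEq n] (A : Matrix n n ℝ) : ℝ :=
  (A.charpoly.roots.sort (· ≥ ·)).getD 1 0

open Classical in
/-- `G` is a connected `k`-regular graph whose second largest eigenvalue is at most `x`. -/
def IsAdmissible (k : ℕ) (x : ℝ) {n : ℕ} (G : SimpleGraph (Fin n)) : Prop :=
  G.Connected ∧ G.IsRegularOfDegree k ∧ secondEigenvalue (G.adjMatrix ℝ) ≤ x

/-- `v(k, x)`: the maximum order of a connected `k`-regular graph whose second largest eigenvalue
is at most `x`, with value `⊤` if these orders are unbounded. -/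
def maxOrder (k : ℕ) (x : ℝ) : ℕ∞ :=
  sSup {N : ℕ∞ | ∃ (n : ℕ) (G : SimpleGraph (Fin n)), IsAdmissible k x G ∧ N = n}

/-- Subdiagonal entry in row `i` (counted from `0`) of `T(k, t, c)`: the subdiagonal is
`(1, …, 1, c)`; there is no such entry in row `0`. -/
def lowerEntry (t : ℕ) (c : ℝ) (i : ℕ) : ℝ :=
  if i = 0 then 0 else if i + 1 = t then c else 1

/-- Superdiagonal entry in row `i` (counted from `0`) of `T(k, t, c)`: the superdiagonal is
`(k, k - 1, …, k - 1)`; there is no such entry in the last row. -/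
def upperEntry (k t : ℕ) (i : ℕ) : ℝ :=
  if i + 1 = t then 0 else if i = 0 then (k : ℝ) else (k : ℝ) - 1

/-- The `t × t` tridiagonal matrix `T(k, t, c)` with subdiagonal `(1, …, 1, c)`, superdiagonal
`(k, k - 1, …, k - 1)` and all row sums equal to `k`. -/
def quotientMatrix (k t : ℕ) (c : ℝ) : Matrix (Fin t) (Fin t) ℝ :=
  Matrix.of fun i j =>
    if (j : ℕ) + 1 = i then lowerEntry t c i
    else if (i : ℕ) + 1 = j then upperEntry k t i
    else if i = j then (k : ℝ) - lowerEntry t c i - upperEntry k t i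
    else 0

/-- The second largest eigenvalue of `T(k, t, c)`. -/
def quotientEigenvalue (k t : ℕ) (c : ℝ) : ℝ := secondEigenvalue (quotientMatrix k t c)

/-- `M(k, t, c) = 1 + ∑_{i=0}^{t-3} k (k-1)^i + k (k-1)^{t-2} / c`, for `2 ≤ t`
(for `t = 2` the sum is empty). -/
def orderBound (k t : ℕ) (c : ℝ) : ℝ :=
  1 + ∑ i ∈ Finset.range (t - 2), (k : ℝ) * ((k : ℝ) - 1) ^ i
    + (k : ℝ) * ((k : ℝ) - 1) ^ (t - 2) / c

/-- The graph `G` attains the bound `M(k, t, c)`: it is a connected `k`-regular graph with second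
largest eigenvalue at most that of `T(k, t, c)`, and it has exactly `M(k, t, c)` vertices. -/
def AttainsBound (k t : ℕ) (c : ℝ) {n : ℕ} (G : SimpleGraph (Fin n)) : Prop :=
  IsAdmissible k (quotientEigenvalue k t c) G ∧ (n : ℝ) = orderBound k t c

end

end RegularGraph

namespace RegularGraph

/-! The core is a linear programming bound, `card_le_orderBound`: for `k ≥ 2`, a `k`-regular graph
whose second eigenvalue is at most that of `T(k, t, c)` has at most `M(k, t, c)` vertices. Write `t
= m + 2`. The characteristic polynomial of `T` is `X - k` times `P = F (m+1) + c (F 0 + ⋯ + F m)`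
(`charpoly_quotientMatrix`), so the eigenvalue in question is the largest root `r` of `P`. Let `K`
be the Christoffel–Darboux kernel at `r`. Up to a positive factor, `P K` is `(X - r) K²`, which is
nonpositive at every adjacency eigenvalue except one copy of `k`; hence the trace of `(P K)(A)` is
at most `P(k) K(k)`. Since the entries of `F i (A)` are walk counts, hence natural numbers, the same
trace is at least `n c K(k)`. As `P(k) = c M`, this gives `n ≤ M`.

The given graph of order `n = M(k, t, c)` stays admissible when the eigenvalue bound is raised
(`quotientEigenvalue_one_le`, `quotientEigenvalue_anti`). The thresholds for `c₁` and `c₂` make the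
new order bound smaller than `n + 1`, or smaller than `n + 2` in the parity cases, where odd `k`
forces even orders. So `n` is the maximum for both eigenvalues. For `k = 1` a direct count replaces
the bound. -/

open Polynomial Matrix

/-! ### The characteristic polynomial of `T(k, t, c)`. -/

/-- The `n × n` tridiagonal matrix with diagonal `a`, superdiagonal `b` and subdiagonal `c`,
the entries of row `i` being `c i`, `a i`, `b i`. -/
def tridiagonal {R : Type*} [Zero R] (a b c : ℕ → R) (n : ℕ) : Matrix (Fin n) (Fin n) R :=
  Matrix.of fun i j =>
    if (j : ℕ) + 1 = i then c i else if (i : ℕ) + 1 = j then b i else if i = j then a i else 0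

theorem det_tridiagonal_succ_succ {R : Type*} [CommRing R] (a b c : ℕ → R) (n : ℕ) :
    (tridiagonal a b c (n + 2)).det =
      a (n + 1) * (tridiagonal a b c (n + 1)).det
        - b n * c (n + 1) * (tridiagonal a b c n).det := by
  rw [det_succ_row _ (Fin.last (n + 1)), Fin.sum_univ_castSucc, Fin.sum_univ_castSucc]
  have hzero : ∀ i : Fin n,
      tridiagonal a b c (n + 2) (Fin.last (n + 1)) i.castSucc.castSucc = 0 := by
    intro i
    have := i.isLt
    simp only [tridiagonal, Matrix.of_apply, Fin.ext_iff, Fin.val_last, Fin.val_castSucc]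
    rw [if_neg (by omega), if_neg (by omega), if_neg (by omega)]
  have hlast : tridiagonal a b c (n + 2) (Fin.last (n + 1)) (Fin.last (n + 1)) = a (n + 1) := by
    simp [tridiagonal]
  have hprev : tridiagonal a b c (n + 2) (Fin.last (n + 1)) (Fin.last n).castSucc = c (n + 1) := by
    simp [tridiagonal]
  have hsub : (tridiagonal a b c (n + 2)).submatrix (Fin.last (n + 1)).succAbove
      (Fin.last (n + 1)).succAbove = tridiagonal a b c (n + 1) := by
    ext i j
    simp [tridiagonal, Fin.ext_iff]
  have hminor : ((tridiagonal a b c (n + 2)).submatrix (Fin.last (n + 1)).succAbove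
      (Fin.last n).castSucc.succAbove).det = b n * (tridiagonal a b c n).det := by
    rw [det_succ_column _ (Fin.last n), Fin.sum_univ_castSucc]
    have h0 : ∀ i : Fin n, (tridiagonal a b c (n + 2)).submatrix (Fin.last (n + 1)).succAbove
        (Fin.last n).castSucc.succAbove i.castSucc (Fin.last n) = 0 := by
      intro i
      have := i.isLt
      simp only [tridiagonal, Matrix.of_apply, Fin.ext_iff, Fin.val_last, Fin.val_castSucc,
        submatrix_apply, Fin.succAbove_last, Fin.succAbove_castSucc_self, Fin.val_succ]
      rw [if_neg (by omega), if_neg (by omega), if_neg (by omega)]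
    have h1 : (tridiagonal a b c (n + 2)).submatrix (Fin.last (n + 1)).succAbove
        (Fin.last n).castSucc.succAbove (Fin.last n) (Fin.last n) = b n := by
      simp [tridiagonal]
      omega
    have h2 : ((tridiagonal a b c (n + 2)).submatrix (Fin.last (n + 1)).succAbove
        (Fin.last n).castSucc.succAbove).submatrix (Fin.last n).succAbove (Fin.last n).succAbove =
        tridiagonal a b c n := by
      ext i j
      have h : (Fin.last n).castSucc.succAbove j.castSucc = j.castSucc.castSucc :=
        Fin.succAbove_castSucc_of_lt _ _ (Fin.castSucc_lt_last j)
      simp only [submatrix_apply, Fin.succAbove_last, h]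
      simp [tridiagonal, Fin.ext_iff]
    simp only [h0, h1, h2]
    simp [← two_mul]
  simp only [hzero, hlast, hprev, hsub, hminor]
  simp only [mul_zero, zero_mul, Finset.sum_const_zero, Fin.val_last, Fin.val_castSucc, zero_add]
  rw [show (-1 : R) ^ (n + 1 + n) = -1 by
      rw [show n + 1 + n = 2 * n + 1 by ring, pow_succ, pow_mul]; simp,
    show (-1 : R) ^ (n + 1 + (n + 1)) = 1 by rw [← two_mul, pow_mul]; simp]
  ring

/-- The polynomials `F i` with `F i (A)` counting the nonbacktracking walks of length `i` in a
`k`-regular graph with adjacency matrix `A`. -/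
noncomputable def walkPoly (k : ℝ) : ℕ → ℝ[X]
  | 0 => 1
  | 1 => X
  | 2 => X ^ 2 - C k
  | n + 3 => X * walkPoly k (n + 2) - C (k - 1) * walkPoly k (n + 1)

/-- The partial sums `G j = F 0 + ⋯ + F j` of the polynomials `walkPoly`. -/
noncomputable def walkSumPoly (k : ℝ) (j : ℕ) : ℝ[X] := ∑ i ∈ Finset.range (j + 1), walkPoly k i

/-- The polynomial `G (m + 1) + (c - 1) G m`, the cofactor of `X - k` in the characteristic
polynomial of `quotientMatrix k (m + 2) c`. -/
noncomputable def cofactorPoly (k c : ℝ) (m : ℕ) : ℝ[X] :=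
  walkSumPoly k (m + 1) + C (c - 1) * walkSumPoly k m

theorem walkSumPoly_zero (k : ℝ) : walkSumPoly k 0 = 1 := by simp [walkSumPoly, walkPoly]

theorem walkSumPoly_succ (k : ℝ) (j : ℕ) :
    walkSumPoly k (j + 1) = walkSumPoly k j + walkPoly k (j + 1) := by
  rw [walkSumPoly, Finset.sum_range_succ, walkSumPoly]

theorem walkSumPoly_one (k : ℝ) : walkSumPoly k 1 = X + 1 := by
  rw [walkSumPoly_succ, walkSumPoly_zero, walkPoly, add_comm]

/-- The recursion of `F` starts irregularly, with `k` in place of `k - 1`; its partial sums obey one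
three-term recursion from the start, which suits the root and kernel arguments. -/
theorem walkSumPoly_succ_succ (k : ℝ) (j : ℕ) :
    walkSumPoly k (j + 2) = X * walkSumPoly k (j + 1) - C (k - 1) * walkSumPoly k j := by
  induction j with
  | zero =>
    rw [walkSumPoly_succ, walkSumPoly_one, walkSumPoly_zero, walkPoly, C_sub, C_1]
    ring
  | succ j ih =>
    have h1 := walkSumPoly_succ k j
    have h2 := walkSumPoly_succ k (j + 1)
    rw [walkSumPoly_succ k (j + 2), walkPoly]
    linear_combination ih - X * h2 + C (k - 1) * h1

theorem sub_mul_walkSumPoly (k : ℝ) (j : ℕ) :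
    (X - C k) * walkSumPoly k (j + 1) = walkPoly k (j + 2) - C (k - 1) * walkPoly k (j + 1) := by
  have h1 := walkSumPoly_succ_succ k j
  have h2 := walkSumPoly_succ k j
  have h3 := walkSumPoly_succ k (j + 1)
  rw [C_sub, C_1] at *
  linear_combination h3 - h1 - (C k - 1) * h2

theorem cofactorPoly_eq (k c : ℝ) (m : ℕ) :
    cofactorPoly k c m = walkPoly k (m + 1) + C c * walkSumPoly k m := by
  rw [cofactorPoly, walkSumPoly_succ, C_sub, C_1]
  ring

theorem charmatrix_quotientMatrix (k t : ℕ) (c : ℝ) :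
    (quotientMatrix k t c).charmatrix =
      tridiagonal (fun i => X - C ((k : ℝ) - lowerEntry t c i - upperEntry k t i))
        (fun i => - C (upperEntry k t i)) (fun i => - C (lowerEntry t c i)) t := by
  ext1 i j
  simp only [charmatrix_apply, quotientMatrix, tridiagonal, Matrix.of_apply]
  by_cases h1 : (j : ℕ) + 1 = i
  · have : i ≠ j := by rintro rfl; omega
    simp [h1, Matrix.diagonal_apply_ne _ this]
  · by_cases h2 : (i : ℕ) + 1 = j
    · have : i ≠ j := by rintro rfl; omega
      simp [h1, h2, Matrix.diagonal_apply_ne _ this]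
    · by_cases h3 : i = j
      · subst h3; simp
      · simp [h1, h2, h3]

/-- The leading principal minors of size at most `m + 1` do not see `c` and follow the recursion of
`F`; only the last expansion step brings in `c`. -/
theorem charpoly_quotientMatrix (k m : ℕ) (c : ℝ) :
    (quotientMatrix k (m + 2) c).charpoly = (X - C (k : ℝ)) * cofactorPoly k c m := by
  rw [Matrix.charpoly, charmatrix_quotientMatrix]
  set a : ℕ → ℝ[X] := fun i => X - C ((k : ℝ) - lowerEntry (m + 2) c i - upperEntry k (m + 2) i)
    with ha
  set b : ℕ → ℝ[X] := fun i => - C (upperEntry k (m + 2) i) with hb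
  set d : ℕ → ℝ[X] := fun i => - C (lowerEntry (m + 2) c i) with hd
  have a0 : a 0 = X := by simp [ha, lowerEntry, upperEntry]
  have ai : ∀ i, 1 ≤ i → i ≤ m → a i = X := by
    intro i h1 h2
    simp [ha, lowerEntry, upperEntry, show i ≠ 0 by omega, show i ≠ m + 1 by omega]
  have al : a (m + 1) = X - C ((k : ℝ) - c) := by simp [ha, lowerEntry, upperEntry]
  have b0 : b 0 = - C (k : ℝ) := by simp [hb, upperEntry]
  have bi : ∀ i, 1 ≤ i → i ≤ m → b i = - C ((k : ℝ) - 1) := by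
    intro i h1 h2
    simp [hb, upperEntry, show i ≠ 0 by omega, show i ≠ m + 1 by omega]
  have di : ∀ i, 1 ≤ i → i ≤ m → d i = -1 := by
    intro i h1 h2
    simp [hd, lowerEntry, show i ≠ 0 by omega, show i ≠ m + 1 by omega]
  have dl : d (m + 1) = - C c := by simp [hd, lowerEntry]
  have hdet : ∀ n, n ≤ m → (tridiagonal a b d n).det = walkPoly k n ∧
      (tridiagonal a b d (n + 1)).det = walkPoly k (n + 1) := by
    intro n
    induction n with
    | zero => intro _; simp [tridiagonal, walkPoly, a0]
    | succ n ih =>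
      intro hn
      obtain ⟨h1, h2⟩ := ih (by omega)
      refine ⟨h2, ?_⟩
      rw [det_tridiagonal_succ_succ, h1, h2, ai _ (by omega) hn, di _ (by omega) hn]
      -- The first superdiagonal entry is `k`, matching the irregular `F 2`.
      rcases n with - | n
      · rw [b0]; simp only [walkPoly]; ring
      · rw [bi _ (by omega) (by omega)]; simp only [walkPoly]; ring
  obtain ⟨h1, h2⟩ := hdet m le_rfl
  rw [det_tridiagonal_succ_succ, h1, h2, al, dl]
  rcases m with - | m
  · rw [b0, cofactorPoly, walkSumPoly_one, walkSumPoly_zero]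
    simp only [walkPoly, C_sub, C_1]
    ring
  · rw [bi _ (by omega) (by omega), cofactorPoly, mul_add, sub_mul_walkSumPoly, mul_left_comm,
      sub_mul_walkSumPoly, walkPoly]
    simp only [C_sub, C_1]
    ring

/-! ### Second entry of a decreasingly sorted multiset. -/

/-- If all members of a multiset but one are smaller than that one, the second entry of the
decreasingly sorted multiset is the largest of the others. -/
theorem sort_getD_one_eq {s : Multiset ℝ} {a b : ℝ} (hb : b ∈ s) (hs : ∀ x ∈ s, x ≤ b)
    (hba : b ≤ a) : ((a ::ₘ s).sort (· ≥ ·)).getD 1 0 = b := by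
  obtain ⟨s, rfl⟩ := Multiset.exists_cons_of_mem hb
  rw [Multiset.sort_cons _ _ _ (fun x hx => (hs x hx).trans hba),
    Multiset.sort_cons _ _ _ (fun x hx => hs x (Multiset.mem_cons_of_mem hx))]
  simp

/-- A member of a multiset that is larger than a bound for the second entry of the decreasingly
sorted multiset can be split off, and the bound holds for all other members. -/
theorem exists_cons_of_sort_getD_one_le {s : Multiset ℝ} {a b : ℝ}
    (h : (s.sort (· ≥ ·)).getD 1 0 ≤ b) (ha : a ∈ s) (hba : b < a) :
    ∃ s', s = a ::ₘ s' ∧ ∀ x ∈ s', x ≤ b := by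
  have hsort := Multiset.pairwise_sort s (· ≥ ·)
  have heq := Multiset.sort_eq s (· ≥ ·)
  rw [← heq] at ha ⊢
  generalize s.sort (· ≥ ·) = l at *
  match l with
  | [] => simp at ha
  | [x] => exact ⟨0, by simpa using Eq.symm (by simpa using ha), by simp⟩
  | x :: y :: l =>
    simp only [List.getD_cons_succ, List.getD_cons_zero] at h
    have hy : ∀ z ∈ y :: l, z ≤ b := by
      intro z hz
      rcases List.mem_cons.1 hz with rfl | hz
      · exact h
      · exact (List.rel_of_pairwise_cons (List.Pairwise.of_cons hsort) hz).trans h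
    refine ⟨(y :: l : List ℝ), ?_, by simpa using hy⟩
    rcases List.mem_cons.1 (Multiset.mem_coe.1 ha) with rfl | hz
    · rfl
    · exact absurd (hy _ hz) (not_le.2 hba)

/-! ### The largest root of the cofactor. -/

theorem eval_walkSumPoly_succ_succ (k x : ℝ) (j : ℕ) :
    (walkSumPoly k (j + 2)).eval x =
      x * (walkSumPoly k (j + 1)).eval x - (k - 1) * (walkSumPoly k j).eval x := by
  rw [walkSumPoly_succ_succ]; simp

theorem eval_cofactorPoly (k c x : ℝ) (m : ℕ) :
    (cofactorPoly k c m).eval x =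
      (walkSumPoly k (m + 1)).eval x + (c - 1) * (walkSumPoly k m).eval x := by
  simp [cofactorPoly]

/-- For `x ≥ k` the recursion gives `G (j+2) - G (j+1) ≥ (k-1) (G (j+1) - G j)`, so growth
propagates. -/
theorem eval_walkSumPoly_pos {k x : ℝ} (hk : 1 ≤ k) (hx : k ≤ x) (j : ℕ) :
    0 < (walkSumPoly k j).eval x ∧
      (walkSumPoly k j).eval x ≤ (walkSumPoly k (j + 1)).eval x := by
  induction j with
  | zero => simp [walkSumPoly_zero, walkSumPoly_one]; linarith
  | succ j ih =>
    refine ⟨ih.1.trans_le ih.2, ?_⟩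
    rw [eval_walkSumPoly_succ_succ]
    nlinarith [mul_nonneg (sub_nonneg.2 hk) (sub_nonneg.2 ih.2),
      mul_nonneg (sub_nonneg.2 hx) (ih.1.le.trans ih.2)]

theorem eval_cofactorPoly_pos {k c x : ℝ} (hk : 1 ≤ k) (hc : 0 < c) (hx : k ≤ x) (m : ℕ) :
    0 < (cofactorPoly k c m).eval x := by
  obtain ⟨h1, h2⟩ := eval_walkSumPoly_pos hk hx m
  rw [eval_cofactorPoly]
  nlinarith [mul_pos hc h1]

/-- A polynomial that is positive on `[b, ∞)` and nonpositive at `a` has a largest real root, which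
lies in `[a, b)`. -/
theorem exists_largest_root {p : ℝ[X]} {a b : ℝ} (ha : p.eval a ≤ 0)
    (hb : ∀ x, b ≤ x → 0 < p.eval x) :
    ∃ r, a ≤ r ∧ r < b ∧ p.eval r = 0 ∧ ∀ x, r < x → 0 < p.eval x := by
  have hab : a ≤ b := by
    by_contra h
    exact absurd (hb a (le_of_not_ge h)) (not_lt.2 ha)
  have hp : p ≠ 0 := by
    rintro rfl
    simpa using hb b le_rfl
  have hex : ∃ y, a ≤ y ∧ p.eval y = 0 := by
    obtain ⟨y, hy, hy0⟩ := intermediate_value_Icc hab p.continuous.continuousOn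
      ⟨ha, (hb b le_rfl).le⟩
    exact ⟨y, hy.1, hy0⟩
  obtain ⟨y, hay, hy⟩ := hex
  obtain ⟨r, hr, hmax⟩ := p.roots.toFinset.exists_max_image id
    ⟨y, by simp [hp, hy]⟩
  simp only [Multiset.mem_toFinset, mem_roots hp, IsRoot.def, id] at hr hmax
  refine ⟨r, hay.trans (hmax y hy), ?_, hr, ?_⟩
  · by_contra h
    exact absurd (hb r (not_lt.1 h)) (by rw [hr]; exact lt_irrefl 0)
  · intro x hx
    by_contra h
    rcases le_total b x with hbx | hbx
    · exact h (hb x hbx)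
    · obtain ⟨z, hz, hz0⟩ := intermediate_value_Icc hbx p.continuous.continuousOn
        ⟨not_lt.1 h, (hb b le_rfl).le⟩
      exact absurd (hmax z hz0) (not_le.2 (hx.trans_le hz.1))

/-- `r` is the largest real root of `cofactorPoly k c m` and is smaller than `k`. -/
structure IsTopRoot (k c : ℝ) (m : ℕ) (r : ℝ) : Prop where
  lt : r < k
  eval_eq_zero : (cofactorPoly k c m).eval r = 0
  eval_pos : ∀ x, r < x → 0 < (cofactorPoly k c m).eval x

theorem IsTopRoot.exists_of_eval_nonpos {k c a : ℝ} {m : ℕ} (hk : 1 ≤ k) (hc : 0 < c)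
    (ha : (cofactorPoly k c m).eval a ≤ 0) : ∃ r, a ≤ r ∧ IsTopRoot k c m r := by
  obtain ⟨r, h1, h2, h3, h4⟩ :=
    exists_largest_root ha (fun x hx => eval_cofactorPoly_pos hk hc hx m)
  exact ⟨r, h1, h2, h3, h4⟩

theorem IsTopRoot.le_of_eval_nonpos {k c a r : ℝ} {m : ℕ} (hr : IsTopRoot k c m r)
    (ha : (cofactorPoly k c m).eval a ≤ 0) : a ≤ r := by
  by_contra h
  exact absurd (hr.eval_pos a (not_le.1 h)) (not_lt.2 ha)

theorem IsTopRoot.walkSumPoly_succ_eq_zero {k r : ℝ} {m : ℕ} (hr : IsTopRoot k 1 m r) :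
    (walkSumPoly k (m + 1)).eval r = 0 := by
  simpa [eval_cofactorPoly] using hr.eval_eq_zero

/-- At a zero of `G (m+1)` the recursion removes `c`. Combined with `G m ≥ 0` there, this puts the
largest root of the next cofactor at or to the right of that zero, for every `c > 0`. -/
theorem eval_cofactorPoly_succ_of_walkSumPoly_eq_zero {k c x : ℝ} {m : ℕ}
    (h : (walkSumPoly k (m + 1)).eval x = 0) :
    (cofactorPoly k c (m + 1)).eval x = -((k - 1) * (walkSumPoly k m).eval x) := by
  rw [eval_cofactorPoly, eval_walkSumPoly_succ_succ, h]
  ring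

/-- To the right of the largest root of `cofactorPoly k 1 m`, which is `G (m + 1)`, all of
`G 0, …, G m` are nonnegative. -/
theorem exists_isTopRoot_one {k : ℝ} (hk : 1 ≤ k) (m : ℕ) :
    ∃ r, IsTopRoot k 1 m r ∧ ∀ x, r ≤ x → ∀ j ≤ m, 0 ≤ (walkSumPoly k j).eval x := by
  induction m with
  | zero =>
    refine ⟨-1, ⟨by linarith, ?_, ?_⟩, ?_⟩
    · simp [eval_cofactorPoly, walkSumPoly_one]
    · intro x hx
      simp [eval_cofactorPoly, walkSumPoly_one]
      linarith
    · intro x _ j hj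
      obtain rfl : j = 0 := by omega
      simp [walkSumPoly_zero]
  | succ m ih =>
    obtain ⟨r, hr, hpos⟩ := ih
    obtain ⟨s, hrs, hs⟩ := IsTopRoot.exists_of_eval_nonpos (c := 1) (a := r) (m := m + 1) hk one_pos
      (by
        rw [eval_cofactorPoly_succ_of_walkSumPoly_eq_zero hr.walkSumPoly_succ_eq_zero]
        exact neg_nonpos.2 (mul_nonneg (by linarith) (hpos r le_rfl m le_rfl)))
    refine ⟨s, hs, fun x hx j hj => ?_⟩
    rcases Nat.le_succ_iff.1 hj with hj | rfl
    · exact hpos x (hrs.trans hx) j hj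
    · rcases (hrs.trans hx).eq_or_lt with h | h
      · rw [← h, hr.walkSumPoly_succ_eq_zero]
      · simpa [eval_cofactorPoly] using (hr.eval_pos x h).le

theorem exists_isTopRoot {k c : ℝ} (hk : 1 ≤ k) (hc : 0 < c) (m : ℕ) :
    ∃ r, IsTopRoot k c m r := by
  rcases m with - | m
  -- For `m = 0` the cofactor is `X + c`.
  · obtain ⟨r, -, hr⟩ := IsTopRoot.exists_of_eval_nonpos (a := -c) (m := 0) hk hc
      (by simp [eval_cofactorPoly, walkSumPoly_one, walkSumPoly_zero])
    exact ⟨r, hr⟩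
  · obtain ⟨r, hr, hpos⟩ := exists_isTopRoot_one hk m
    obtain ⟨s, -, hs⟩ := IsTopRoot.exists_of_eval_nonpos (c := c) (a := r) (m := m + 1) hk hc
      (by
        rw [eval_cofactorPoly_succ_of_walkSumPoly_eq_zero hr.walkSumPoly_succ_eq_zero]
        exact neg_nonpos.2 (mul_nonneg (by linarith) (hpos r le_rfl m le_rfl)))
    exact ⟨s, hs⟩

/-- For `1 < k` the polynomials `G 0, …, G m` are positive to the right of the
largest root of `cofactorPoly k c m`. -/
theorem IsTopRoot.walkSumPoly_pos {k c r : ℝ} {m : ℕ} (hk : 1 < k) (hc : 0 < c)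
    (hr : IsTopRoot k c m r) {x : ℝ} (hx : r ≤ x) {j : ℕ} (hj : j ≤ m) :
    0 < (walkSumPoly k j).eval x := by
  induction m generalizing c r x j with
  | zero =>
    obtain rfl : j = 0 := by omega
    simp [walkSumPoly_zero]
  | succ m ih =>
    obtain ⟨s, hs⟩ := exists_isTopRoot hk.le one_pos m
    have hneg : (cofactorPoly k c (m + 1)).eval s < 0 := by
      rw [eval_cofactorPoly_succ_of_walkSumPoly_eq_zero hs.walkSumPoly_succ_eq_zero]
      exact neg_neg_of_pos (mul_pos (by linarith) (ih one_pos hs le_rfl le_rfl))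
    -- The largest zero `s` of `G (m+1)` lies strictly left of `r`; strictness comes from `k > 1`.
    have hsr : s < r := by
      refine lt_of_le_of_ne (hr.le_of_eval_nonpos hneg.le) ?_
      rintro rfl
      exact hneg.ne hr.eval_eq_zero
    rcases Nat.le_succ_iff.1 hj with hj | rfl
    · exact ih one_pos hs (hsr.le.trans hx) hj
    · simpa [eval_cofactorPoly] using hs.eval_pos x (hsr.trans_le hx)

theorem cofactorPoly_ne_zero {k c : ℝ} (hk : 1 ≤ k) (hc : 0 < c) (m : ℕ) :
    cofactorPoly k c m ≠ 0 := by
  intro h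
  simpa [h] using eval_cofactorPoly_pos hk hc le_rfl m

theorem IsTopRoot.quotientEigenvalue_eq {k m : ℕ} {c r : ℝ} (hk : 1 ≤ k) (hc : 0 < c)
    (hr : IsTopRoot k c m r) : quotientEigenvalue k (m + 2) c = r := by
  have hk' : (1 : ℝ) ≤ k := by exact_mod_cast hk
  have h0 := cofactorPoly_ne_zero hk' hc m
  rw [quotientEigenvalue, secondEigenvalue, charpoly_quotientMatrix,
    roots_mul (mul_ne_zero (X_sub_C_ne_zero _) h0), roots_X_sub_C, Multiset.singleton_add]
  refine sort_getD_one_eq ((mem_roots h0).2 hr.eval_eq_zero) (fun x hx => ?_) hr.lt.le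
  exact hr.le_of_eval_nonpos (le_of_eq ((mem_roots h0).1 hx))

theorem isTopRoot_quotientEigenvalue {k m : ℕ} {c : ℝ} (hk : 1 ≤ k) (hc : 0 < c) :
    IsTopRoot k c m (quotientEigenvalue k (m + 2) c) := by
  obtain ⟨r, hr⟩ := exists_isTopRoot (k := k) (by exact_mod_cast hk) hc m
  rwa [hr.quotientEigenvalue_eq hk hc]

/-- The second largest eigenvalue of `T(k, t, c)` is nonincreasing in `c`. -/
theorem quotientEigenvalue_anti {k m : ℕ} {c c' : ℝ} (hk : 1 ≤ k) (hc' : 0 < c') (h : c' ≤ c) :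
    quotientEigenvalue k (m + 2) c ≤ quotientEigenvalue k (m + 2) c' := by
  have hk' : (1 : ℝ) ≤ k := by exact_mod_cast hk
  have hr := isTopRoot_quotientEigenvalue (m := m) hk (hc'.trans_le h)
  have hr' := isTopRoot_quotientEigenvalue (m := m) hk hc'
  refine hr'.le_of_eval_nonpos ?_
  set r := quotientEigenvalue k (m + 2) c
  have h0 : 0 ≤ (walkSumPoly k m).eval r := by
    rcases m with - | m
    · simp [walkSumPoly_zero]
    · obtain ⟨s, hs, hpos⟩ := exists_isTopRoot_one hk' m
      have hsr : s ≤ r := hr.le_of_eval_nonpos (by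
        rw [eval_cofactorPoly_succ_of_walkSumPoly_eq_zero hs.walkSumPoly_succ_eq_zero]
        exact neg_nonpos.2 (mul_nonneg (by linarith) (hpos s le_rfl m le_rfl)))
      rcases hsr.eq_or_lt with h1 | h1
      · rw [← h1, hs.walkSumPoly_succ_eq_zero]
      · simpa [eval_cofactorPoly] using (hs.eval_pos r h1).le
  have h2 := hr.eval_eq_zero
  rw [eval_cofactorPoly] at h2 ⊢
  -- The two cofactors differ at `r` by `(c' - c) G m (r) ≤ 0`.
  nlinarith [mul_nonneg (sub_nonneg.2 h) h0]

/-- The second largest eigenvalue of `T(k, t, 1)` is at most that of `T(k, t + 1, c)`. -/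
theorem quotientEigenvalue_one_le {k m : ℕ} {c : ℝ} (hk : 1 ≤ k) (hc : 0 < c) :
    quotientEigenvalue k (m + 2) 1 ≤ quotientEigenvalue k (m + 3) c := by
  have hk' : (1 : ℝ) ≤ k := by exact_mod_cast hk
  obtain ⟨r, hr, hpos⟩ := exists_isTopRoot_one hk' m
  rw [hr.quotientEigenvalue_eq hk one_pos]
  refine (isTopRoot_quotientEigenvalue (m := m + 1) hk hc).le_of_eval_nonpos ?_
  rw [eval_cofactorPoly_succ_of_walkSumPoly_eq_zero hr.walkSumPoly_succ_eq_zero]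
  exact neg_nonpos.2 (mul_nonneg (by linarith) (hpos r le_rfl m le_rfl))

/-! ### The Christoffel–Darboux kernel and values at `k`. -/

/-- The Christoffel–Darboux kernel of the polynomials `G j`, with second argument `y`. -/
noncomputable def kernelPoly (k y : ℝ) (m : ℕ) : ℝ[X] :=
  ∑ j ∈ Finset.range (m + 1), C ((k - 1) ^ (m - j) * (walkSumPoly k j).eval y) * walkSumPoly k j

theorem kernelPoly_succ (k y : ℝ) (m : ℕ) :
    kernelPoly k y (m + 1) = C (k - 1) * kernelPoly k y m +
      C ((walkSumPoly k (m + 1)).eval y) * walkSumPoly k (m + 1) := by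
  rw [kernelPoly, Finset.sum_range_succ, kernelPoly, Finset.mul_sum]
  congr 1
  · refine Finset.sum_congr rfl fun j hj => ?_
    rw [Nat.succ_sub (Nat.lt_succ_iff.1 (Finset.mem_range.1 hj)), pow_succ, ← mul_assoc, ← C_mul]
    congr 2
    ring
  · simp

theorem sub_mul_kernelPoly (k y : ℝ) (m : ℕ) :
    (X - C y) * kernelPoly k y m = C ((walkSumPoly k m).eval y) * walkSumPoly k (m + 1) -
      C ((walkSumPoly k (m + 1)).eval y) * walkSumPoly k m := by
  induction m with
  | zero => simp [kernelPoly, walkSumPoly_zero, walkSumPoly_one]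
  | succ m ih =>
    rw [kernelPoly_succ, mul_add, mul_left_comm, ih, eval_walkSumPoly_succ_succ,
      walkSumPoly_succ_succ]
    simp only [C_sub, C_mul, C_1]
    ring

/-- A root of the cofactor satisfies `G (m+1) (r) = -(c-1) G m (r)`, which turns the right side of
Christoffel–Darboux into a multiple of the cofactor. -/
theorem IsTopRoot.sub_mul_kernelPoly {k c r : ℝ} {m : ℕ} (hr : IsTopRoot k c m r) :
    (X - C r) * kernelPoly k r m = C ((walkSumPoly k m).eval r) * cofactorPoly k c m := by
  have h := hr.eval_eq_zero
  rw [eval_cofactorPoly] at h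
  rw [RegularGraph.sub_mul_kernelPoly, cofactorPoly, eq_neg_of_add_eq_zero_left h]
  simp only [C_neg, C_mul]
  ring

theorem eval_walkPoly_succ (k : ℝ) (i : ℕ) : (walkPoly k (i + 1)).eval k = k * (k - 1) ^ i := by
  induction i using Nat.strong_induction_on with
  | _ i ih =>
    match i with
    | 0 => simp [walkPoly]
    | 1 => simp [walkPoly]; ring
    | n + 2 =>
      rw [walkPoly, eval_sub, eval_mul, eval_mul, ih (n + 1) (by omega), ih n (by omega)]
      simp only [eval_X, eval_C]
      ring

theorem eval_walkSumPoly_self (k : ℝ) (m : ℕ) :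
    (walkSumPoly k m).eval k = 1 + ∑ i ∈ Finset.range m, k * (k - 1) ^ i := by
  rw [walkSumPoly, Finset.sum_range_succ', eval_add, eval_finsetSum, add_comm]
  simp [eval_walkPoly_succ, walkPoly]

theorem eval_cofactorPoly_self (k m : ℕ) {c : ℝ} (hc : c ≠ 0) :
    (cofactorPoly k c m).eval (k : ℝ) = c * orderBound k (m + 2) c := by
  rw [cofactorPoly_eq, eval_add, eval_mul, eval_C, eval_walkPoly_succ, eval_walkSumPoly_self,
    orderBound, Nat.add_sub_cancel]
  field_simp
  ring

/-! ### Nonbacktracking walks and lower bounds for traces. -/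

section Walks

variable {V : Type*} [Fintype V] [DecidableEq V] (G : SimpleGraph V) [DecidableRel G.Adj]

/-- The number of nonbacktracking walks of length `i + 1` from `x` whose last edge goes from `y`
to `z`. -/
def dartWalkCount : ℕ → V → V → V → ℕ
  | 0, x, y, z => if x = y ∧ G.Adj y z then 1 else 0
  | i + 1, x, y, z =>
    if G.Adj y z then ∑ w, if w = z then 0 else dartWalkCount i x w y else 0

theorem dartWalkCount_of_not_adj (i : ℕ) (x : V) {y z : V} (h : ¬ G.Adj y z) :
    dartWalkCount G i x y z = 0 := by
  cases i <;> simp [dartWalkCount, h]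

theorem dartWalkCount_succ_add (i : ℕ) (x : V) {y z : V} (h : G.Adj y z) :
    dartWalkCount G (i + 1) x y z + dartWalkCount G i x z y = ∑ w, dartWalkCount G i x w y := by
  rw [dartWalkCount, if_pos h, add_comm, Fintype.sum_eq_add_sum_compl z,
    Fintype.sum_eq_add_sum_compl z (fun w => dartWalkCount G i x w y), if_pos rfl, zero_add]
  congr 1
  refine Finset.sum_congr rfl fun w hw => if_neg ?_
  simpa using hw

/-- The number of nonbacktracking walks of length `i` from `x` to `z`. -/
def walkCount : ℕ → V → V → ℕ
  | 0, x, z => if x = z then 1 else 0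
  | i + 1, x, z => ∑ y, dartWalkCount G i x y z

theorem sum_neighborFinset_dartWalkCount (i : ℕ) (x w : V) :
    ∑ z ∈ G.neighborFinset w, dartWalkCount G i x z w = walkCount G (i + 1) x w := by
  refine Finset.sum_subset (Finset.subset_univ _) fun z _ hz => ?_
  exact dartWalkCount_of_not_adj G i x fun h => hz (by simpa using h.symm)

/-- Append the edge from `z` to `w` to a walk: either the result is nonbacktracking, or the last
edge already went from `w` to `z`. -/
theorem sum_neighborFinset_walkCount (i : ℕ) (x w : V) :
    ∑ z ∈ G.neighborFinset w, walkCount G (i + 1) x z = walkCount G (i + 2) x w +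
      ∑ z ∈ G.neighborFinset w, dartWalkCount G i x w z := by
  rw [← sum_neighborFinset_dartWalkCount, ← Finset.sum_add_distrib]
  refine Finset.sum_congr rfl fun z hz => ?_
  rw [dartWalkCount_succ_add G i x (by simpa [G.adj_comm] using hz), walkCount]

theorem sum_neighborFinset_walkCount_one {k : ℕ} (hG : G.IsRegularOfDegree k) (x w : V) :
    ∑ z ∈ G.neighborFinset w, walkCount G 1 x z =
      walkCount G 2 x w + k * walkCount G 0 x w := by
  rw [sum_neighborFinset_walkCount, walkCount]
  congr 1
  rw [Finset.sum_congr rfl (g := fun _ => if x = w then 1 else 0), Finset.sum_const,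
    G.card_neighborFinset_eq_degree, hG.degree_eq, smul_eq_mul]
  intro z hz
  have h : G.Adj w z := by simpa using hz
  simp [dartWalkCount, h]

/-- A nonempty walk to `w` has `k - 1` nonbacktracking continuations, which evaluates the
backtracking term. The additive form avoids subtraction in `ℕ`. -/
theorem sum_neighborFinset_walkCount_succ {k : ℕ} (hG : G.IsRegularOfDegree k) (i : ℕ) (x w : V) :
    ∑ z ∈ G.neighborFinset w, walkCount G (i + 2) x z + walkCount G (i + 1) x w =
      walkCount G (i + 3) x w + k * walkCount G (i + 1) x w := by
  rw [sum_neighborFinset_walkCount, add_assoc, ← sum_neighborFinset_dartWalkCount G i,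
    ← Finset.sum_add_distrib, sum_neighborFinset_dartWalkCount,
    Finset.sum_congr rfl (g := fun _ => walkCount G (i + 1) x w), Finset.sum_const,
    G.card_neighborFinset_eq_degree, hG.degree_eq, smul_eq_mul]
  intro z hz
  rw [dartWalkCount_succ_add G i x (by simpa using hz), walkCount]

/-- The polynomials `walkPoly` evaluated at the adjacency matrix count nonbacktracking walks. -/
theorem aeval_adjMatrix_walkPoly {k : ℕ} (hG : G.IsRegularOfDegree k) (i : ℕ) (x z : V) :
    aeval (G.adjMatrix ℝ) (walkPoly k i) x z = walkCount G i x z := by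
  induction i using Nat.strong_induction_on generalizing x z with
  | _ i ih =>
    match i with
    | 0 => simp [walkPoly, walkCount, Matrix.one_apply]
    | 1 => simp [walkPoly, walkCount, dartWalkCount, SimpleGraph.adjMatrix_apply, ite_and]
    | 2 =>
      have h := sum_neighborFinset_walkCount_one G hG x z
      have h1 : ∀ u, G.adjMatrix ℝ x u = walkCount G 1 x u := fun u => by
        simpa [walkPoly] using ih 1 (by omega) x u
      have h0 : (1 : Matrix V V ℝ) x z = walkCount G 0 x z := by
        simpa [walkPoly] using ih 0 (by omega) x z
      rw [walkPoly, map_sub, map_pow, aeval_X, aeval_C, sq, Matrix.sub_apply,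
        SimpleGraph.mul_adjMatrix_apply, Algebra.algebraMap_eq_smul_one, Matrix.smul_apply, h0,
        Finset.sum_congr rfl (fun u _ => h1 u), smul_eq_mul, sub_eq_iff_eq_add]
      exact_mod_cast h
    | n + 3 =>
      have h := sum_neighborFinset_walkCount_succ G hG n x z
      rw [walkPoly, mul_comm X, map_sub, map_mul, map_mul, aeval_X, aeval_C, Matrix.sub_apply,
        SimpleGraph.mul_adjMatrix_apply, Algebra.algebraMap_eq_smul_one, smul_mul_assoc, one_mul,
        Matrix.smul_apply, ih (n + 1) (by omega),
        Finset.sum_congr rfl (fun u _ => ih (n + 2) (by omega) x u), smul_eq_mul]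
      have h' : (∑ z ∈ G.neighborFinset z, (walkCount G (n + 2) x z : ℝ)) + walkCount G (n + 1) x z =
        walkCount G (n + 3) x z + k * walkCount G (n + 1) x z := by exact_mod_cast h
      linear_combination h'

theorem aeval_adjMatrix_mulVec_one {k : ℕ} (hG : G.IsRegularOfDegree k) (p : ℝ[X]) :
    aeval (G.adjMatrix ℝ) p *ᵥ (fun _ => (1 : ℝ)) = fun _ => p.eval (k : ℝ) := by
  induction p using Polynomial.induction_on' with
  | add p q hp hq => rw [map_add, add_mulVec, hp, hq]; ext; simp
  | monomial n a =>
    rw [aeval_monomial, Algebra.algebraMap_eq_smul_one, smul_mul_assoc, one_mul, smul_mulVec]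
    have h : (G.adjMatrix ℝ) ^ n *ᵥ (fun _ => (1 : ℝ)) = fun _ => (k : ℝ) ^ n := by
      induction n with
      | zero => simp
      | succ n ih =>
        rw [pow_succ, ← mulVec_mulVec, show G.adjMatrix ℝ *ᵥ (fun _ => (1 : ℝ)) =
          (k : ℝ) • fun _ => (1 : ℝ) by ext v; simp [hG.degree_eq v], mulVec_smul, ih]
        ext; simp [pow_succ, mul_comm]
    rw [h]
    ext; simp

theorem aeval_adjMatrix_transpose (p : ℝ[X]) :
    (aeval (G.adjMatrix ℝ) p)ᵀ = aeval (G.adjMatrix ℝ) p := by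
  induction p using Polynomial.induction_on' with
  | add p q hp hq => rw [map_add, transpose_add, hp, hq]
  | monomial n a =>
    rw [aeval_monomial, Algebra.algebraMap_eq_smul_one, smul_mul_assoc, one_mul, transpose_smul,
      transpose_pow, SimpleGraph.transpose_adjMatrix]

theorem trace_aeval_adjMatrix_mul (p q : ℝ[X]) :
    (aeval (G.adjMatrix ℝ) (p * q)).trace =
      ∑ x, ∑ y, aeval (G.adjMatrix ℝ) p x y * aeval (G.adjMatrix ℝ) q x y := by
  rw [map_mul, Matrix.trace]
  refine Finset.sum_congr rfl fun x _ => ?_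
  rw [Matrix.diag_apply, Matrix.mul_apply]
  refine Finset.sum_congr rfl fun y _ => ?_
  conv_lhs => rw [← aeval_adjMatrix_transpose G q, transpose_apply]

theorem trace_walkPoly_mul_nonneg {k : ℕ} (hG : G.IsRegularOfDegree k) (i j : ℕ) :
    0 ≤ (aeval (G.adjMatrix ℝ) (walkPoly k i * walkPoly k j)).trace := by
  rw [trace_aeval_adjMatrix_mul]
  simp only [aeval_adjMatrix_walkPoly G hG]
  positivity

/-- The trace is the sum of squared walk counts, and `a ≤ a²` for natural `a`. The unsquared counts
have row sums `F i (k)`. -/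
theorem card_mul_eval_le_trace_walkPoly_sq {k : ℕ} (hG : G.IsRegularOfDegree k) (i : ℕ) :
    Fintype.card V * (walkPoly k i).eval (k : ℝ) ≤
      (aeval (G.adjMatrix ℝ) (walkPoly k i * walkPoly k i)).trace := by
  have h : (Fintype.card V * (walkPoly k i).eval (k : ℝ)) =
      ∑ x : V, (aeval (G.adjMatrix ℝ) (walkPoly k i) *ᵥ (fun _ => (1 : ℝ))) x := by
    simp [aeval_adjMatrix_mulVec_one G hG]
  rw [trace_aeval_adjMatrix_mul, h]
  simp only [Matrix.mulVec, dotProduct, mul_one, aeval_adjMatrix_walkPoly G hG]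
  exact_mod_cast Finset.sum_le_sum fun x _ => Finset.sum_le_sum fun y _ => Nat.le_mul_self _

/-- Expand the cofactor in the `F j`: all traces are nonnegative, and only the term `j = i` is kept.
-/
theorem card_mul_eval_le_trace_cofactorPoly_mul {k : ℕ} (hG : G.IsRegularOfDegree k) {c : ℝ}
    (hc : 0 ≤ c) {i m : ℕ} (hi : i ≤ m) :
    Fintype.card V * c * (walkPoly k i).eval (k : ℝ) ≤
      (aeval (G.adjMatrix ℝ) (cofactorPoly k c m * walkPoly k i)).trace := by
  have hsum : (aeval (G.adjMatrix ℝ) (cofactorPoly k c m * walkPoly k i)).trace =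
      (aeval (G.adjMatrix ℝ) (walkPoly k (m + 1) * walkPoly k i)).trace +
        c * ∑ j ∈ Finset.range (m + 1),
          (aeval (G.adjMatrix ℝ) (walkPoly k j * walkPoly k i)).trace := by
    rw [cofactorPoly_eq, walkSumPoly, add_mul, mul_assoc, Finset.sum_mul, map_add, trace_add,
      ← smul_eq_C_mul, map_smul, trace_smul, map_sum, trace_sum, smul_eq_mul]
  rw [hsum]
  have h1 := Finset.single_le_sum (f := fun j =>
    (aeval (G.adjMatrix ℝ) (walkPoly k j * walkPoly k i)).trace)
    (fun j _ => trace_walkPoly_mul_nonneg G hG j i)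
    (Finset.mem_range.2 (Nat.lt_succ_of_le hi))
  have h2 := card_mul_eval_le_trace_walkPoly_sq G hG i
  have h3 := trace_walkPoly_mul_nonneg G hG (m + 1) i
  nlinarith [mul_le_mul_of_nonneg_left (h2.trans h1) hc]

/-- The kernel is a nonnegative combination of `F 0, …, F m`, so the preceding estimate sums up. -/
theorem card_mul_eval_le_trace_cofactorPoly_mul_kernelPoly {k : ℕ} (hk : 1 ≤ k)
    (hG : G.IsRegularOfDegree k) {c y : ℝ} (hc : 0 ≤ c) {m : ℕ}
    (hy : ∀ j ≤ m, 0 ≤ (walkSumPoly k j).eval y) :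
    Fintype.card V * c * (kernelPoly k y m).eval (k : ℝ) ≤
      (aeval (G.adjMatrix ℝ) (cofactorPoly k c m * kernelPoly k y m)).trace := by
  have hk' : (0 : ℝ) ≤ k - 1 := sub_nonneg.2 (by exact_mod_cast hk)
  rw [kernelPoly, eval_finsetSum, Finset.mul_sum, Finset.mul_sum, map_sum, trace_sum]
  refine Finset.sum_le_sum fun j hj => ?_
  have hjm : j ≤ m := Nat.lt_succ_iff.1 (Finset.mem_range.1 hj)
  rw [mul_left_comm, ← smul_eq_C_mul, ← smul_eq_C_mul, map_smul, trace_smul, eval_smul, smul_eq_mul,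
    smul_eq_mul, mul_left_comm]
  refine mul_le_mul_of_nonneg_left ?_ (mul_nonneg (pow_nonneg hk' _) (hy j hjm))
  rw [walkSumPoly, eval_finsetSum, Finset.mul_sum, Finset.mul_sum, map_sum, trace_sum]
  exact Finset.sum_le_sum fun i hi => card_mul_eval_le_trace_cofactorPoly_mul G hG hc
    ((Nat.lt_succ_iff.1 (Finset.mem_range.1 hi)).trans hjm)

end Walks

/-! ### Spectral side and the linear programming bound. -/

theorem trace_aeval_eq_sum_roots {n : Type*} [Fintype n] [DecidableEq n] {A : Matrix n n ℝ}
    (hA : A.IsHermitian) (p : ℝ[X]) :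
    (aeval A p).trace = (A.charpoly.roots.map fun x => p.eval x).sum := by
  have h : aeval A p = Unitary.conjStarAlgAut ℝ _ hA.eigenvectorUnitary
      (diagonal fun i => p.eval (hA.eigenvalues i)) := by
    conv_lhs => rw [hA.spectral_theorem]
    have hd : (diagonal fun i => p.eval (hA.eigenvalues i)) =
        aeval (diagonal (RCLike.ofReal ∘ hA.eigenvalues : n → ℝ)) p := by
      have := aeval_algHom_apply (diagonalAlgHom (n := n) (α := ℝ) ℝ)
        (RCLike.ofReal ∘ hA.eigenvalues : n → ℝ) p
      rw [diagonalAlgHom_apply, diagonalAlgHom_apply] at this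
      rw [this]
      congr 1
      ext i
      simp
    rw [hd]
    exact aeval_algHom_apply (Unitary.conjStarAlgAut ℝ (Matrix n n ℝ)
      hA.eigenvectorUnitary).toAlgEquiv.toAlgHom _ p
  rw [h, Unitary.conjStarAlgAut_apply, trace_mul_cycle]
  simp [hA.roots_charpoly_eq_eigenvalues]

theorem natCast_mem_roots_charpoly_adjMatrix {V : Type*} [Fintype V] [DecidableEq V] [Nonempty V]
    (G : SimpleGraph V) [DecidableRel G.Adj] {k : ℕ} (hG : G.IsRegularOfDegree k) :
    (k : ℝ) ∈ (G.adjMatrix ℝ).charpoly.roots := by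
  rw [mem_roots (charpoly_monic _).ne_zero, ← Matrix.charpoly_toLin',
    ← Module.End.hasEigenvalue_iff_isRoot_charpoly]
  refine Module.End.hasEigenvalue_of_hasEigenvector (x := fun _ => (1 : ℝ)) ⟨?_, ?_⟩
  · rw [Module.End.mem_eigenspace_iff, toLin'_apply]
    ext v
    simp [hG.degree_eq v]
  · intro h
    simpa using congrFun h (Classical.arbitrary V)

/-- The linear programming bound: a `k`-regular graph whose second largest eigenvalue is at most
that of `T(k, m + 2, c)` has at most `M(k, m + 2, c)` vertices. -/
theorem card_le_orderBound {V : Type*} [Fintype V] [DecidableEq V] [Nonempty V]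
    (G : SimpleGraph V) [DecidableRel G.Adj] {k : ℕ} (hk : 1 < k) (hG : G.IsRegularOfDegree k)
    {c : ℝ} (hc : 0 < c) {m : ℕ}
    (h : secondEigenvalue (G.adjMatrix ℝ) ≤ quotientEigenvalue k (m + 2) c) :
    (Fintype.card V : ℝ) ≤ orderBound k (m + 2) c := by
  have hr := isTopRoot_quotientEigenvalue (m := m) hk.le hc
  have hk' : (1 : ℝ) < k := by exact_mod_cast hk
  set r := quotientEigenvalue k (m + 2) c
  have hpos : ∀ j ≤ m, 0 < (walkSumPoly k j).eval r := fun j hj =>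
    hr.walkSumPoly_pos hk' hc le_rfl hj
  have hker : 0 < (kernelPoly k r m).eval (k : ℝ) := by
    rw [kernelPoly, eval_finsetSum]
    refine Finset.sum_pos (fun j hj => ?_) (by simp)
    rw [eval_mul, eval_C]
    exact mul_pos (mul_pos (pow_pos (by linarith) _)
      (hpos j (Nat.lt_succ_iff.1 (Finset.mem_range.1 hj)))) (eval_walkSumPoly_pos hk'.le le_rfl j).1
  -- Christoffel–Darboux at `r` makes the test polynomial a square times `x - r`.
  have heval : ∀ x, (walkSumPoly k m).eval r * (cofactorPoly k c m * kernelPoly k r m).eval x =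
      (x - r) * (kernelPoly k r m).eval x ^ 2 := by
    intro x
    have h := congrArg (fun p : ℝ[X] => p.eval x) hr.sub_mul_kernelPoly
    simp only [eval_mul, eval_sub, eval_X, eval_C] at h
    rw [eval_mul]
    linear_combination -(kernelPoly k r m).eval x * h
  have hupper : (aeval (G.adjMatrix ℝ) (cofactorPoly k c m * kernelPoly k r m)).trace ≤
      (cofactorPoly k c m * kernelPoly k r m).eval (k : ℝ) := by
    have hA : (G.adjMatrix ℝ).IsHermitian := by
      rw [IsHermitian, conjTranspose_eq_transpose_of_trivial, SimpleGraph.transpose_adjMatrix]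
    -- As `r < k`, one copy of `k` splits off and all other eigenvalues are at most `r`.
    obtain ⟨s, hs, hle⟩ := exists_cons_of_sort_getD_one_le h
      (natCast_mem_roots_charpoly_adjMatrix G hG) hr.lt
    rw [trace_aeval_eq_sum_roots hA, hs, Multiset.map_cons, Multiset.sum_cons]
    refine add_le_of_nonpos_right ((Multiset.sum_le_card_nsmul _ 0 fun y hy => ?_).trans (by simp))
    obtain ⟨x, hx, rfl⟩ := Multiset.mem_map.1 hy
    refine nonpos_of_mul_nonpos_right ?_ (hpos m le_rfl)
    rw [heval]
    exact mul_nonpos_of_nonpos_of_nonneg (sub_nonpos.2 (hle x hx)) (sq_nonneg _)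
  have hlower := card_mul_eval_le_trace_cofactorPoly_mul_kernelPoly G hk.le hG hc.le
    (fun j hj => (hpos j hj).le)
  have := hlower.trans hupper
  rw [eval_mul, eval_cofactorPoly_self k m hc.ne'] at this
  have := le_of_mul_le_mul_right this hker
  rw [mul_comm] at this
  exact le_of_mul_le_mul_left this hc

end RegularGraph

/-! ### From order bounds to maximum orders. -/

namespace RegularGraph

theorem card_le_two_of_isRegularOfDegree_one {V : Type*} [Fintype V] {G : SimpleGraph V}
    [G.LocallyFinite] (hG : G.IsRegularOfDegree 1) (hconn : G.Connected) : Fintype.card V ≤ 2 := by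
  classical
  obtain ⟨v⟩ := hconn.nonempty
  have huniq : ∀ u, ∃! w, G.Adj u w := fun u =>
    G.degree_eq_one_iff_existsUnique_adj.1 (hG.degree_eq u)
  obtain ⟨w, hvw, hw⟩ := huniq v
  have hmem : ∀ u, u = v ∨ u = w := by
    intro u
    have h := (G.reachable_iff_reflTransGen v u).1 (hconn.preconnected v u)
    induction h with
    | refl => exact Or.inl rfl
    | @tail a b _ hab ih =>
      rcases ih with rfl | rfl
      · exact Or.inr (hw b hab)
      · exact Or.inl ((huniq a).unique hab hvw.symm)
  calc Fintype.card V = (Finset.univ : Finset V).card := rfl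
    _ ≤ ({v, w} : Finset V).card := Finset.card_le_card fun u _ => by simpa using hmem u
    _ ≤ 2 := Finset.card_le_two

theorem IsAdmissible.even_mul {k n : ℕ} {x : ℝ} {G : SimpleGraph (Fin n)}
    (hG : IsAdmissible k x G) : Even (n * k) := by
  classical
  have h := G.sum_degrees_eq_twice_card_edges
  have hd : ∀ v, G.degree v = k := fun v => by convert hG.2.1 v
  simp only [hd, Finset.sum_const, Finset.card_univ, Fintype.card_fin, smul_eq_mul] at h
  exact ⟨_, h.trans (two_mul _)⟩

theorem IsAdmissible.lt_order {k n : ℕ} {x : ℝ} {G : SimpleGraph (Fin n)}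
    (hG : IsAdmissible k x G) : k < n := by
  classical
  obtain ⟨v⟩ := hG.1.nonempty
  have hd : G.degree v = k := by convert hG.2.1 v
  simpa [hd] using G.degree_lt_card_verts v

theorem IsAdmissible.le_orderBound {k m n : ℕ} {c : ℝ} {G : SimpleGraph (Fin n)} (hk : 1 < k)
    (hc : 0 < c) (hG : IsAdmissible k (quotientEigenvalue k (m + 2) c) G) :
    (n : ℝ) ≤ orderBound k (m + 2) c := by
  classical
  have := hG.1.nonempty
  have hreg : G.IsRegularOfDegree k := fun v => by convert hG.2.1 v
  have h : secondEigenvalue (G.adjMatrix ℝ) ≤ quotientEigenvalue k (m + 2) c := by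
    convert hG.2.2
  simpa using card_le_orderBound G hk hreg hc h

theorem maxOrder_eq_of_forall_le {k n : ℕ} {x : ℝ} {G : SimpleGraph (Fin n)}
    (hG : IsAdmissible k x G)
    (h : ∀ (n' : ℕ) (G' : SimpleGraph (Fin n')), IsAdmissible k x G' → n' ≤ n) :
    maxOrder k x = n := by
  refine le_antisymm (sSup_le ?_) (le_sSup ⟨n, G, hG, rfl⟩)
  rintro _ ⟨n', G', hG', rfl⟩
  exact_mod_cast h n' G' hG'

/-- If a graph of order `n` is admissible for `x`, and `M(k, m + 2, c)` together with the parity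
of `n' k` rules out admissible orders `n' > n` for the second largest eigenvalue of
`T(k, m + 2, c) ≥ x`, then the maximum orders for `x` and for that eigenvalue agree. -/
theorem maxOrder_quotientEigenvalue_eq {k m n : ℕ} {c x : ℝ} (hk : 1 ≤ k) (hc : 0 < c)
    {G : SimpleGraph (Fin n)} (hG : IsAdmissible k x G)
    (hx : x ≤ quotientEigenvalue k (m + 2) c)
    (h : 1 < k → ∀ n' : ℕ, (n' : ℝ) ≤ orderBound k (m + 2) c → Even (n' * k) → n' ≤ n) :
    maxOrder k (quotientEigenvalue k (m + 2) c) = maxOrder k x := by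
  have hmax : ∀ (n' : ℕ) (G' : SimpleGraph (Fin n')),
      IsAdmissible k (quotientEigenvalue k (m + 2) c) G' → n' ≤ n := by
    intro n' G' hG'
    -- For `k = 1` connectedness gives `n' ≤ 2`, while `k < n` gives `2 ≤ n`.
    rcases hk.eq_or_lt with rfl | hk
    · classical
      have h1 := card_le_two_of_isRegularOfDegree_one (G := G') (fun v => by convert hG'.2.1 v) hG'.1
      have h2 := hG.lt_order
      rw [Fintype.card_fin] at h1
      omega
    · exact h hk n' (hG'.le_orderBound hk hc) hG'.even_mul
  have mono : ∀ {n' : ℕ} {G' : SimpleGraph (Fin n')}, IsAdmissible k x G' →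
      IsAdmissible k (quotientEigenvalue k (m + 2) c) G' :=
    fun h => ⟨h.1, h.2.1, h.2.2.trans hx⟩
  rw [maxOrder_eq_of_forall_le (mono hG) hmax,
    maxOrder_eq_of_forall_le hG fun n' G' hG' => hmax n' G' (mono hG')]

/-- With `c = 1` the last layer of `M(k, m + 2, c)` becomes a regular term of the sum, so passing to
`m + 3` adds just one new layer. -/
theorem orderBound_succ (k m : ℕ) (c : ℝ) :
    orderBound k (m + 3) c =
      orderBound k (m + 2) 1 + (k : ℝ) * ((k : ℝ) - 1) ^ (m + 1) / c := by
  simp only [orderBound, show m + 3 - 2 = m + 1 from rfl, Nat.add_sub_cancel,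
    Finset.sum_range_succ, div_one]
  ring

theorem le_of_lt_add_one_cast {n' n : ℕ} {b : ℝ} (h : (n' : ℝ) ≤ b) (hb : b < n + 1) : n' ≤ n := by
  have : (n' : ℝ) < ((n + 1 : ℕ) : ℝ) := by push_cast; exact h.trans_lt hb
  exact Nat.lt_succ_iff.1 (Nat.cast_lt.1 this)

theorem le_of_lt_add_two_of_even {n' n k : ℕ} {b : ℝ} (h : (n' : ℝ) ≤ b) (hb : b < n + 2)
    (hn : Even n) (hk : Odd k) (hnk : Even (n' * k)) : n' ≤ n := by
  have h1 : n' < n + 2 := by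
    have : (n' : ℝ) < ((n + 2 : ℕ) : ℝ) := by push_cast; exact h.trans_lt hb
    exact Nat.cast_lt.1 this
  have h2 : Even n' := (Nat.even_mul.1 hnk).resolve_right (Nat.not_even_iff_odd.2 hk)
  rcases hn with ⟨a, rfl⟩
  rcases h2 with ⟨b, rfl⟩
  omega

/-- For `d > 0`, `K ≥ 0`, `c > 0`, the threshold `c - d c² / (K + d c)` is nonnegative, and beyond
it `K / c' < K / c + d`. -/
theorem div_lt_div_add_of_threshold_lt {K c d c' : ℝ} (hK : 0 ≤ K) (hc : 0 < c) (hd : 0 < d)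
    (h : c - d * c ^ 2 / (K + d * c) < c') : 0 < c' ∧ K / c' < K / c + d := by
  have hdc := mul_pos hd hc
  have hpos : 0 < K + d * c := by linarith
  have heq : c - d * c ^ 2 / (K + d * c) = K * c / (K + d * c) := by
    field_simp
    ring
  rw [heq] at h
  have hc' : 0 < c' := (div_nonneg (mul_nonneg hK hc.le) hpos.le).trans_lt h
  refine ⟨hc', ?_⟩
  rw [div_lt_iff₀ hpos] at h
  have h2 : K / c + d = (K + d * c) / c := by field_simp
  rw [h2, div_lt_div_iff₀ hc' hc]
  linarith

end RegularGraph

theorem mainTheorem9 (k t : ℕ) (hk : 1 ≤ k) (ht : 2 ≤ t) (c : ℝ)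
    (hG : ∃ (n : ℕ) (G : SimpleGraph (Fin n)), RegularGraph.AttainsBound k t c G) :
    (c = 1 →
      (∀ c₁ : ℝ, (k : ℝ) * ((k : ℝ) - 1) ^ (t - 1) < c₁ →
        RegularGraph.maxOrder k (RegularGraph.quotientEigenvalue k (t + 1) c₁) =
          RegularGraph.maxOrder k (RegularGraph.quotientEigenvalue k t c)) ∧
      ((∃ m : ℕ, Even m ∧ (m : ℝ) = RegularGraph.orderBound k t c) → Odd k →
        ∀ c₁ : ℝ, (k : ℝ) * ((k : ℝ) - 1) ^ (t - 1) / 2 < c₁ →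
          RegularGraph.maxOrder k (RegularGraph.quotientEigenvalue k (t + 1) c₁) =
            RegularGraph.maxOrder k (RegularGraph.quotientEigenvalue k t c))) ∧
    (1 < c →
      (∀ c₂ : ℝ, c - c ^ 2 / ((k : ℝ) * ((k : ℝ) - 1) ^ (t - 2) + c) < c₂ → c₂ ≤ c →
        RegularGraph.maxOrder k (RegularGraph.quotientEigenvalue k t c₂) =
          RegularGraph.maxOrder k (RegularGraph.quotientEigenvalue k t c)) ∧
      ((∃ m : ℕ, Even m ∧ (m : ℝ) = RegularGraph.orderBound k t c) → Odd k →
        ∀ c₂ : ℝ, c - 2 * c ^ 2 / ((k : ℝ) * ((k : ℝ) - 1) ^ (t - 2) + 2 * c) < c₂ → c₂ ≤ c →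
          RegularGraph.maxOrder k (RegularGraph.quotientEigenvalue k t c₂) =
            RegularGraph.maxOrder k (RegularGraph.quotientEigenvalue k t c))) := by
  open RegularGraph in
  obtain ⟨m, rfl⟩ := Nat.exists_eq_add_of_le' ht
  obtain ⟨n, G, hG, hn⟩ := hG
  have hk1 : (0 : ℝ) ≤ k - 1 := sub_nonneg.2 (by exact_mod_cast hk)
  have hK : ∀ j, 0 ≤ (k : ℝ) * ((k : ℝ) - 1) ^ j := fun j =>
    mul_nonneg (Nat.cast_nonneg k) (pow_nonneg hk1 j)
  have heven : (∃ m' : ℕ, Even m' ∧ (m' : ℝ) = orderBound k (m + 2) c) → Even n := by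
    rintro ⟨m', hm', h⟩
    rwa [← Nat.cast_injective (R := ℝ) (h.trans hn.symm)]
  have hsucc : m + 2 - 1 = m + 1 := rfl
  refine ⟨?_, fun hc => ?_⟩
  · rintro rfl
    rw [hsucc]
    refine ⟨fun c₁ h => ?_, fun hev hodd c₁ h => ?_⟩
    · have hc₁ : 0 < c₁ := (hK _).trans_lt h
      refine maxOrder_quotientEigenvalue_eq hk hc₁ hG (quotientEigenvalue_one_le hk hc₁) ?_
      intro _ n' hn' _
      refine le_of_lt_add_one_cast hn' ?_
      rw [orderBound_succ, ← hn]
      exact add_lt_add_right ((div_lt_one hc₁).2 h) _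
    · have hc₁ : 0 < c₁ := (div_nonneg (hK _) two_pos.le).trans_lt h
      refine maxOrder_quotientEigenvalue_eq hk hc₁ hG (quotientEigenvalue_one_le hk hc₁) ?_
      intro _ n' hn' hnk
      refine le_of_lt_add_two_of_even hn' ?_ (heven hev) hodd hnk
      rw [orderBound_succ, ← hn]
      exact add_lt_add_right ((div_lt_iff₀ hc₁).2 (by linarith)) _
  · rw [Nat.add_sub_cancel] at *
    have hc0 : 0 < c := one_pos.trans hc
    -- Only the last summand of `M` depends on `c`; the slack `d` is `1` in general and `2` under
    -- the parity assumption.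
    have hbound : ∀ c' d : ℝ, (k : ℝ) * ((k : ℝ) - 1) ^ m / c' <
        (k : ℝ) * ((k : ℝ) - 1) ^ m / c + d → orderBound k (m + 2) c' < n + d := by
      intro c' d h
      rw [hn, orderBound, orderBound, Nat.add_sub_cancel]
      linarith
    refine ⟨fun c₂ h hle => ?_, fun hev hodd c₂ h hle => ?_⟩
    · obtain ⟨hc₂, hlt⟩ := div_lt_div_add_of_threshold_lt (hK m) hc0 one_pos (by simpa using h)
      exact maxOrder_quotientEigenvalue_eq hk hc₂ hG (quotientEigenvalue_anti hk hc₂ hle)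
        fun _ n' hn' _ => le_of_lt_add_one_cast hn' (hbound c₂ 1 hlt)
    · obtain ⟨hc₂, hlt⟩ := div_lt_div_add_of_threshold_lt (hK m) hc0 two_pos h
      exact maxOrder_quotientEigenvalue_eq hk hc₂ hG (quotientEigenvalue_anti hk hc₂ hle)
        fun _ n' hn' hnk =>
          le_of_lt_add_two_of_even hn' (hbound c₂ 2 hlt) (heven hev) hodd hnk
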